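/- Write a bicomplex number $Z = z_1 + j z_2$ ($z_1,z_2\in\mathbb{C}$, $j^2=-1$, $ij=ji$) as $Z=\alpha e_+ + \beta e_-$ with $e_\pm = \frac{1\pm ij}{2}$, $\alpha = z_1 - i z_2$, $\beta = z_1 + i z_2$, and a function $F:\mathbb{BC}\to\mathbb{BC}$ as $F = F^+ e_+ + F^- e_-$ with $F^\pm:\mathbb{BC}\to\mathbb{C}$. Put $Z^* = \overline{\alpha} e_+ + \overline{\beta} e_-$, $\Re_{hyp} Z = \frac12(Z+Z^*) = \Re(\alpha) e_+ + \Re(\beta) e_-$, $\mathbb{D} = \{x + y\,ij : x,y\in\mathbb{R}\}$, and $$\partial_{Z}F = (\partial_{\alpha}F^+)e_+ + (\partial_{\beta}F^-)e_-,\qquad \partial_{Z^*}F = (\partial_{\overline\alpha}F^+)e_+ + (\partial_{\overline\beta}F^-)e_-,\qquad \Delta_{bc} = \partial_Z\partial_{Z^*} = \Delta_\alpha e_+ + \Delta_\beta e_-,$$ where $\Delta_\alpha = \partial_\alpha\partial_{\overline\alpha}$ and $\Delta_\beta=\partial_\beta\partial_{\overline\beta}$. A function $F:\mathbb{BC}\to\mathbb{BC}$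 is called $\Delta_{bc}$-polyharmonic of order $n$ if it is of class $\mathcal{C}^{2n}$ and $n$ is the smallest positive integer with $\Delta_{bc}^n F=0$. For an integer $n\ge 1$ let $A_n$ be the set of functions $\sum_{k=0}^{n-1} a_k(z)\overline{z}^k$ on $\mathbb{C}$ with $a_k$ entire and $a_{n-1}\not\equiv 0$ (polyanalytic functions of exact order $n$), and let $A_0=\{0\}$. **Lemma.** Let $F:\mathbb{BC}\to\mathbb{D}$ be a $\Delta_{bc}$-polyharmonic function of order $m$. Then there exist nonnegative integers $r,s$ with $m=\max(r,s)$, where $r$ (respectively $s$) is the smallest positive integer with $\Delta_\alpha^r F^+=0$ (respectively $\Delta_\beta^s F^-=0$), and a function $G:\mathbb{BC}\to\mathbb{BC}$ of the form $$G(\alpha e_+ + \beta e_-) = \varphi_\beta(\alpha)\, e_+ + \phi_\alpha(\beta)\, e_-,$$ with $\varphi_\beta\in A_r$ for every $\beta\in\mathbb{C}$ and $\phi_\alpha\in A_s$ for every $\alpha\in\mathbb{C}$, such that 1. $\Re_{hyp}(G) = F$, and $G$ is $\Delta_{bc}$-polyharmonic of order $m$; 2. $G\in\ker(\partial_{Z^*}^m)$,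 that is, $\partial_{Z^*}^m G=0$. -/

import Mathlib

noncomputable section

namespace Bicomplex

/-- The bicomplex numbers `Z = z₁ + j z₂` with `z₁ z₂ : ℂ` and `j² = -1`, as a commutative
`ℂ`-algebra; `Z.re` is `z₁` and `Z.im` is `z₂`. -/
abbrev BC : Type := QuadraticAlgebra ℂ (-1) 0

/-- The hyperbolic unit `k = i j`. -/
def kUnit : BC := ⟨0, Complex.I⟩

/-- The idempotent `e₊ = (1 + i j) / 2`. -/
def ePlus : BC := (1 / 2 : ℂ) • (1 + kUnit)

/-- The idempotent `e₋ = (1 - i j) / 2`. -/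
def eMinus : BC := (1 / 2 : ℂ) • (1 - kUnit)

/-- The idempotent coordinate `α = z₁ - i z₂` of `Z`. -/
def plus (Z : BC) : ℂ := Z.re - Complex.I * Z.im

/-- The idempotent coordinate `β = z₁ + i z₂` of `Z`. -/
def minus (Z : BC) : ℂ := Z.re + Complex.I * Z.im

/-- The bicomplex number `α e₊ + β e₋`. -/
def idem (α β : ℂ) : BC := α • ePlus + β • eMinus

/-- The conjugation `Z* = conj z₁ - j conj z₂`. -/
def starConj (Z : BC) : BC := ⟨starRingEnd ℂ Z.re, -starRingEnd ℂ Z.im⟩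

/-- The hyperbolic numbers `𝔻 = {x + y k : x, y ∈ ℝ}`. -/
def hyperbolic : Set BC := {Z | ∃ x y : ℝ, Z = (x : ℂ) • (1 : BC) + (y : ℂ) • kUnit}

/-- The hyperbolic real part `(Z + Z*) / 2`. -/
def reHyp (Z : BC) : BC := (1 / 2 : ℂ) • (Z + starConj Z)

theorem one_re : (1 : BC).re = 1 := rfl

theorem one_im : (1 : BC).im = 0 := rfl

@[simp] theorem plus_idem (α β : ℂ) : plus (idem α β) = α := by
  simp [plus, idem, ePlus, eMinus, kUnit, one_re, one_im]
  linear_combination ((β - α) / 2) * Complex.I_mul_I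

@[simp] theorem minus_idem (α β : ℂ) : minus (idem α β) = β := by
  simp [minus, idem, ePlus, eMinus, kUnit, one_re, one_im]
  linear_combination ((α - β) / 2) * Complex.I_mul_I

@[simp] theorem idem_plus_minus (Z : BC) : idem (plus Z) (minus Z) = Z := by
  ext
  · simp [plus, minus, idem, ePlus, eMinus, kUnit, one_re]
    ring
  · simp [plus, minus, idem, ePlus, eMinus, kUnit, one_im]
    linear_combination (-Z.im) * Complex.I_mul_I

/-- `Re_hyp Z = Re α e₊ + Re β e₋`. -/
theorem reHyp_eq (Z : BC) : reHyp Z = idem ((plus Z).re : ℂ) ((minus Z).re : ℂ) := by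
  ext <;> apply Complex.ext <;>
    simp [reHyp, starConj, plus, minus, idem, ePlus, eMinus, kUnit, one_re, one_im] <;> ring

/-- The Wirtinger derivative `∂g/∂z = (∂g/∂x - i ∂g/∂y) / 2`. -/
def dz (g : ℂ → ℂ) (z : ℂ) : ℂ :=
  (1 / 2) * (fderiv ℝ g z 1 - Complex.I * fderiv ℝ g z Complex.I)

/-- The Wirtinger derivative `∂g/∂z̄ = (∂g/∂x + i ∂g/∂y) / 2`. -/
def dzbar (g : ℂ → ℂ) (z : ℂ) : ℂ :=
  (1 / 2) * (fderiv ℝ g z 1 + Complex.I * fderiv ℝ g z Complex.I)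

/-- `∂/∂α` for complex-valued functions of `Z = α e₊ + β e₋`. -/
def dAlpha (f : BC → ℂ) (Z : BC) : ℂ := dz (fun α => f (idem α (minus Z))) (plus Z)

/-- `∂/∂ᾱ`. -/
def dAlphaBar (f : BC → ℂ) (Z : BC) : ℂ := dzbar (fun α => f (idem α (minus Z))) (plus Z)

/-- `∂/∂β`. -/
def dBeta (f : BC → ℂ) (Z : BC) : ℂ := dz (fun β => f (idem (plus Z) β)) (minus Z)

/-- `∂/∂β̄`. -/
def dBetaBar (f : BC → ℂ) (Z : BC) : ℂ := dzbar (fun β => f (idem (plus Z) β)) (minus Z)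

/-- `Δ_α = ∂²/∂α∂ᾱ`. -/
def lapAlpha (f : BC → ℂ) : BC → ℂ := dAlpha (dAlphaBar f)

/-- `Δ_β = ∂²/∂β∂β̄`. -/
def lapBeta (f : BC → ℂ) : BC → ℂ := dBeta (dBetaBar f)

/-- `∂/∂Z = (∂/∂α) e₊ + (∂/∂β) e₋`, acting on `F = F⁺ e₊ + F⁻ e₋` componentwise. -/
def dZ (F : BC → BC) (Z : BC) : BC :=
  idem (dAlpha (fun W => plus (F W)) Z) (dBeta (fun W => minus (F W)) Z)

/-- `∂/∂Z* = (∂/∂ᾱ) e₊ + (∂/∂β̄) e₋`, acting on `F = F⁺ e₊ + F⁻ e₋` componentwise. -/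
def dZstar (F : BC → BC) (Z : BC) : BC :=
  idem (dAlphaBar (fun W => plus (F W)) Z) (dBetaBar (fun W => minus (F W)) Z)

/-- The bicomplex Laplace operator `Δ_bc = ∂²/∂Z∂Z*`. -/
def lapBC (F : BC → BC) : BC → BC := dZ (dZstar F)

/-- `Δ_bc = Δ_α e₊ + Δ_β e₋`. -/
theorem lapBC_apply (F : BC → BC) (Z : BC) :
    lapBC F Z = idem (lapAlpha (fun W => plus (F W)) Z) (lapBeta (fun W => minus (F W)) Z) := by
  simp [lapBC, dZ, dZstar, lapAlpha, lapBeta]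

/-- `F : BC → BC` is of class `C^n` in the real sense, read in the real-linear coordinates
`(z₁, z₂)` on the source and on the target. -/
def IsCn (n : ℕ) (F : BC → BC) : Prop :=
  ContDiff ℝ n (fun p : ℂ × ℂ => ((F ⟨p.1, p.2⟩).re, (F ⟨p.1, p.2⟩).im))

/-- `F` is `Δ_bc`-polyharmonic of (exact) order `n`: it is of class `C^{2n}` and `n` is the
smallest positive integer with `Δ_bc^n F = 0`. -/
def IsPolyharmonic (n : ℕ) (F : BC → BC) : Prop :=
  IsCn (2 * n) F ∧ IsLeast {k : ℕ | 0 < k ∧ lapBC^[k] F = 0} n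

/-- The set `A_n^z[z̄]` of polyanalytic functions of exact order `n` on `ℂ`: the functions
`∑_{k<n} a_k(z) z̄^k` with entire `a_k` and `a_{n-1} ≢ 0` (the zero function alone if `n = 0`). -/
def polyanalytic (n : ℕ) : Set (ℂ → ℂ) :=
  {f | ∃ a : ℕ → ℂ → ℂ, (∀ k, Differentiable ℂ (a k)) ∧ (n ≠ 0 → a (n - 1) ≠ 0) ∧
    ∀ z, f z = ∑ k ∈ Finset.range n, a k z * (starRingEnd ℂ z) ^ k}

end Bicomplex

end

/-! In idempotent coordinates everything decouples: with β frozen, F⁺ is a real-valued function of α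
killed by the `r`-th power of ∂∂̄, and symmetrically for F⁻. By Almansi (`exists_almansi`) such a
function is Re Σ_{k<r} |α|^{2k} V_k(α) with V_k entire. The sum inside is polyanalytic, so it is
killed by ∂̄^r and (∂∂̄)^r, and it is the natural candidate for the component of G.

Two points remain. The V_k are chosen separately for each β, yet G must be jointly C^{2m}. Requiring
V_k(0) to be real makes them recoverable: on |ζ| = R the function is the real part of the entire
function Σ R^{2k} V_k, which the Schwarz integral reconstructs from F⁺. Using `r` radii and
inverting a Vandermonde matrix expresses each V_k through integrals of F⁺ (`contDiff_almansi`).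

Moreover, the order must be exactly `r` for every β, although particular slices of F⁺ may have lower
order. Replacing V_{r-1} by V_{r-1} + i leaves the real part unchanged, and the new coefficient is
nonzero because V_{r-1}(0) is real (`exists_polyanalytic_rePart_eq`). The order of G is not below
`m`, because Re commutes with powers of ∂∂̄. -/

noncomputable section

namespace Bicomplex

open ComplexConjugate MeasureTheory

/-! ### Wirtinger calculus in one variable -/

/-- The real-linear map `v ↦ c v + d v̄`. -/
def wirtingerCLM (c d : ℂ) : ℂ →L[ℝ] ℂ :=
  c • ContinuousLinearMap.id ℝ ℂ + d • (Complex.conjCLE : ℂ →L[ℝ] ℂ)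

theorem wirtingerCLM_apply (c d v : ℂ) : wirtingerCLM c d v = c * v + d * conj v := by
  simp [wirtingerCLM]

/-- The Wirtinger derivatives are the coefficients of v and v̄ in the real differential, so they can
be read off from any `HasFDerivAt` statement in this form. -/
theorem fderiv_eq_wirtingerCLM (g : ℂ → ℂ) (z : ℂ) :
    fderiv ℝ g z = wirtingerCLM (dz g z) (dzbar g z) := by
  ext v
  have hv : v = v.re • (1 : ℂ) + v.im • Complex.I := by
    simp
  have hc : conj v = v.re - v.im * Complex.I := by
    apply Complex.ext <;> simp
  have hv' : v = v.re + v.im * Complex.I := by simp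
  rw [wirtingerCLM_apply, hc]
  conv_lhs => rw [hv, map_add, map_smul, map_smul]
  conv_rhs => rw [hv']
  simp only [dz, dzbar, Complex.real_smul, Complex.add_re, Complex.ofReal_re, Complex.mul_re,
    Complex.I_re, Complex.ofReal_im, Complex.I_im, Complex.add_im, Complex.mul_im, mul_zero,
    mul_one, add_zero, zero_add, sub_self]
  linear_combination (v.im * fderiv ℝ g z Complex.I) * Complex.I_mul_I

theorem dz_eq_of_hasFDerivAt {g : ℂ → ℂ} {z c d : ℂ} (h : HasFDerivAt g (wirtingerCLM c d) z) :
    dz g z = c := by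
  simp only [dz, h.fderiv, wirtingerCLM_apply, map_one, Complex.conj_I]
  linear_combination (-(1 / 2) * (c - d)) * Complex.I_mul_I

theorem dzbar_eq_of_hasFDerivAt {g : ℂ → ℂ} {z c d : ℂ} (h : HasFDerivAt g (wirtingerCLM c d) z) :
    dzbar g z = d := by
  simp only [dzbar, h.fderiv, wirtingerCLM_apply, map_one, Complex.conj_I]
  linear_combination ((1 / 2) * (c - d)) * Complex.I_mul_I

theorem hasFDerivAt_wirtingerCLM {g : ℂ → ℂ} {z : ℂ} (h : DifferentiableAt ℝ g z) :
    HasFDerivAt g (wirtingerCLM (dz g z) (dzbar g z)) z := by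
  rw [← fderiv_eq_wirtingerCLM]
  exact h.hasFDerivAt

theorem hasDerivAt_of_dzbar_eq_zero {g : ℂ → ℂ} {z : ℂ} (h : DifferentiableAt ℝ g z)
    (h0 : dzbar g z = 0) : HasDerivAt g (dz g z) z := by
  have h1 := hasFDerivAt_wirtingerCLM h
  rw [h0] at h1
  rw [hasDerivAt_iff_hasFDerivAt]
  refine .of_isLittleO (h1.isLittleO.congr_left fun x => ?_)
  simp [wirtingerCLM_apply, mul_comm]

theorem hasFDerivAt_of_hasDerivAt {g : ℂ → ℂ} {z c : ℂ} (h : HasDerivAt g c z) :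
    HasFDerivAt g (wirtingerCLM c 0) z := by
  refine .of_isLittleO (h.hasFDerivAt.isLittleO.congr_left fun x => ?_)
  simp [wirtingerCLM_apply, mul_comm]

theorem dz_conj (g : ℂ → ℂ) (z : ℂ) : dz (fun w => conj (g w)) z = conj (dzbar g z) := by
  have h : fderiv ℝ (fun w => conj (g w)) z
      = (Complex.conjCLE : ℂ →L[ℝ] ℂ).comp (fderiv ℝ g z) :=
    Complex.conjCLE.comp_fderiv
  simp only [dz, dzbar, h]
  simp [sub_eq_add_neg, Complex.conj_ofNat]

theorem dzbar_conj (g : ℂ → ℂ) (z : ℂ) : dzbar (fun w => conj (g w)) z = conj (dz g z) := by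
  have h : fderiv ℝ (fun w => conj (g w)) z
      = (Complex.conjCLE : ℂ →L[ℝ] ℂ).comp (fderiv ℝ g z) :=
    Complex.conjCLE.comp_fderiv
  simp only [dz, dzbar, h]
  simp [Complex.conj_ofNat]

theorem dz_add {f g : ℂ → ℂ} {z : ℂ} (hf : DifferentiableAt ℝ f z) (hg : DifferentiableAt ℝ g z) :
    dz (fun w => f w + g w) z = dz f z + dz g z := by
  simp only [dz, fderiv_fun_add hf hg, add_apply]
  ring

theorem dzbar_add {f g : ℂ → ℂ} {z : ℂ} (hf : DifferentiableAt ℝ f z)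
    (hg : DifferentiableAt ℝ g z) : dzbar (fun w => f w + g w) z = dzbar f z + dzbar g z := by
  simp only [dzbar, fderiv_fun_add hf hg, add_apply]
  ring

theorem dz_const_mul {f : ℂ → ℂ} {z : ℂ} (c : ℂ) (hf : DifferentiableAt ℝ f z) :
    dz (fun w => c * f w) z = c * dz f z := by
  simp only [dz, fderiv_const_mul hf, smul_apply, smul_eq_mul]
  ring

theorem dzbar_const_mul {f : ℂ → ℂ} {z : ℂ} (c : ℂ) (hf : DifferentiableAt ℝ f z) :
    dzbar (fun w => c * f w) z = c * dzbar f z := by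
  simp only [dzbar, fderiv_const_mul hf, smul_apply, smul_eq_mul]
  ring

theorem contDiff_dz {n : ℕ} {g : ℂ → ℂ} (h : ContDiff ℝ (n + 1) g) : ContDiff ℝ n (dz g) := by
  have h1 : ContDiff ℝ n (fderiv ℝ g) := h.fderiv_right le_rfl
  unfold dz
  fun_prop

theorem contDiff_dzbar {n : ℕ} {g : ℂ → ℂ} (h : ContDiff ℝ (n + 1) g) :
    ContDiff ℝ n (dzbar g) := by
  have h1 : ContDiff ℝ n (fderiv ℝ g) := h.fderiv_right le_rfl
  unfold dzbar
  fun_prop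

theorem dzbar_dz_comm {g : ℂ → ℂ} (h : ContDiff ℝ 2 g) : dzbar (dz g) = dz (dzbar g) := by
  ext z
  have h1 : Differentiable ℝ (fderiv ℝ g) :=
    (h.fderiv_right (m := 1) (by norm_num)).differentiable (by norm_num)
  -- Commutation of ∂ and ∂̄ reduces to the symmetry of the second real derivative in the directions
  -- 1 and i.
  have hs : IsSymmSndFDerivAt ℝ g z := h.contDiffAt.isSymmSndFDerivAt (by simp)
  have hz : HasFDerivAt (dz g) ((1 / 2 : ℂ) •
      (((fderiv ℝ (fderiv ℝ g) z).flip 1) - Complex.I • (fderiv ℝ (fderiv ℝ g) z).flip Complex.I))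
      z := by
    have a1 := (h1 z).hasFDerivAt.clm_apply (hasFDerivAt_const (1 : ℂ) z)
    have a2 := (h1 z).hasFDerivAt.clm_apply (hasFDerivAt_const Complex.I z)
    simp only [ContinuousLinearMap.comp_zero, zero_add] at a1 a2
    exact (a1.sub (a2.const_mul Complex.I)).const_mul (1 / 2)
  have hzb : HasFDerivAt (dzbar g) ((1 / 2 : ℂ) •
      (((fderiv ℝ (fderiv ℝ g) z).flip 1) + Complex.I • (fderiv ℝ (fderiv ℝ g) z).flip Complex.I))
      z := by
    have a1 := (h1 z).hasFDerivAt.clm_apply (hasFDerivAt_const (1 : ℂ) z)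
    have a2 := (h1 z).hasFDerivAt.clm_apply (hasFDerivAt_const Complex.I z)
    simp only [ContinuousLinearMap.comp_zero, zero_add] at a1 a2
    exact (a1.add (a2.const_mul Complex.I)).const_mul (1 / 2)
  have hsym := hs 1 Complex.I
  rw [dzbar, dz, hz.fderiv, hzb.fderiv]
  simp only [smul_apply, sub_apply,
    add_apply, ContinuousLinearMap.flip_apply, smul_eq_mul, hsym]
  ring

/-! ### The operator ∂∂̄ and real parts -/

/-- The operator `∂²/∂z∂z̄` on functions of one complex variable. -/
def lap (g : ℂ → ℂ) : ℂ → ℂ := dz (dzbar g)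

theorem contDiff_lap {n : ℕ} {g : ℂ → ℂ} (h : ContDiff ℝ (n + 2) g) : ContDiff ℝ n (lap g) :=
  contDiff_dz (contDiff_dzbar (by exact_mod_cast h))

theorem lap_conj {g : ℂ → ℂ} (h : ContDiff ℝ 2 g) :
    lap (fun w => conj (g w)) = fun w => conj (lap g w) := by
  unfold lap
  rw [funext (dzbar_conj g)]
  ext z
  rw [dz_conj, dzbar_dz_comm h]

theorem differentiable_dzbar {g : ℂ → ℂ} (h : ContDiff ℝ 2 g) : Differentiable ℝ (dzbar g) :=
  (contDiff_dzbar (n := 1) (by norm_num; exact h)).differentiable (by norm_num)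

theorem lap_add {f g : ℂ → ℂ} (hf : ContDiff ℝ 2 f) (hg : ContDiff ℝ 2 g) :
    lap (fun w => f w + g w) = fun w => lap f w + lap g w := by
  unfold lap
  have : dzbar (fun w => f w + g w) = fun w => dzbar f w + dzbar g w := by
    ext z
    exact dzbar_add (hf.differentiable (by norm_num) z) (hg.differentiable (by norm_num) z)
  ext z
  rw [this, dz_add (differentiable_dzbar hf z) (differentiable_dzbar hg z)]

theorem lap_const_mul {f : ℂ → ℂ} (c : ℂ) (hf : ContDiff ℝ 2 f) :
    lap (fun w => c * f w) = fun w => c * lap f w := by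
  unfold lap
  have : dzbar (fun w => c * f w) = fun w => c * dzbar f w := by
    ext z
    exact dzbar_const_mul c (hf.differentiable (by norm_num) z)
  ext z
  rw [this, dz_const_mul c (differentiable_dzbar hf z)]

/-- The real part of a function, as a complex-valued function. -/
def rePart (g : ℂ → ℂ) : ℂ → ℂ := fun z => ((g z).re : ℂ)

theorem rePart_eq (g : ℂ → ℂ) : rePart g = fun z => (1 / 2) * (g z + conj (g z)) := by
  ext z
  rw [rePart, Complex.add_conj]
  push_cast
  ring

theorem contDiff_rePart {n : WithTop ℕ∞} {g : ℂ → ℂ} (h : ContDiff ℝ n g) :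
    ContDiff ℝ n (rePart g) :=
  Complex.ofRealCLM.contDiff.comp (Complex.reCLM.contDiff.comp h)

theorem contDiff_conj {n : WithTop ℕ∞} {g : ℂ → ℂ} (h : ContDiff ℝ n g) :
    ContDiff ℝ n (fun z => conj (g z)) :=
  Complex.conjCLE.contDiff.comp h

theorem lap_rePart {g : ℂ → ℂ} (h : ContDiff ℝ 2 g) : lap (rePart g) = rePart (lap g) := by
  rw [rePart_eq, lap_const_mul _ (h.add (contDiff_conj h)), lap_add h (contDiff_conj h),
    lap_conj h, rePart_eq]

theorem lap_iterate_rePart (k : ℕ) {g : ℂ → ℂ} (h : ContDiff ℝ (2 * k : ℕ) g) :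
    lap^[k] (rePart g) = rePart (lap^[k] g) := by
  induction k generalizing g with
  | zero => rfl
  | succ k ih =>
    rw [Function.iterate_succ_apply, Function.iterate_succ_apply,
      lap_rePart (h.of_le (by norm_cast; omega)), ih]
    exact contDiff_lap (by exact_mod_cast h)

/-! ### Polyanalytic sums -/

/-- The function `∑_{k<n} a_k(z) z̄^k`. -/
def polySum (n : ℕ) (a : ℕ → ℂ → ℂ) : ℂ → ℂ :=
  fun z => ∑ k ∈ Finset.range n, a k z * conj z ^ k

theorem contDiff_of_entire {n : WithTop ℕ∞} {g : ℂ → ℂ} (h : Differentiable ℂ g) :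
    ContDiff ℝ n g :=
  (h.contDiff (n := n)).restrict_scalars ℝ

theorem contDiff_polySum {m : WithTop ℕ∞} (n : ℕ) {a : ℕ → ℂ → ℂ}
    (ha : ∀ k, Differentiable ℂ (a k)) : ContDiff ℝ m (polySum n a) := by
  unfold polySum
  refine ContDiff.sum fun k _ => (contDiff_of_entire (ha k)).mul ?_
  exact (contDiff_conj contDiff_id).pow k

theorem hasFDerivAt_polySum (n : ℕ) {a : ℕ → ℂ → ℂ} (ha : ∀ k, Differentiable ℂ (a k)) (z : ℂ) :
    HasFDerivAt (polySum n a) (wirtingerCLM (polySum n (fun k => deriv (a k)) z)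
      -- At k = 0 the truncated exponent is harmless, since the factor `k` vanishes.
      (∑ k ∈ Finset.range n, a k z * (k * conj z ^ (k - 1)))) z := by
  have hc : HasFDerivAt (fun w : ℂ => conj w) (Complex.conjCLE : ℂ →L[ℝ] ℂ) z :=
    Complex.conjCLE.hasFDerivAt
  have := HasFDerivAt.fun_sum (u := Finset.range n) fun k _ =>
    (hasFDerivAt_of_hasDerivAt (ha k z).hasDerivAt).mul (hc.pow k)
  refine this.congr_fderiv ?_
  ext v
  simp only [sum_apply, wirtingerCLM_apply, polySum, Finset.sum_mul,
    ← Finset.sum_add_distrib]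
  refine Finset.sum_congr rfl fun k _ => ?_
  simp [wirtingerCLM_apply]
  ring

theorem dz_polySum (n : ℕ) {a : ℕ → ℂ → ℂ} (ha : ∀ k, Differentiable ℂ (a k)) :
    dz (polySum n a) = polySum n (fun k => deriv (a k)) :=
  funext fun z => dz_eq_of_hasFDerivAt (hasFDerivAt_polySum n ha z)

theorem dzbar_polySum_succ (n : ℕ) {a : ℕ → ℂ → ℂ} (ha : ∀ k, Differentiable ℂ (a k)) :
    dzbar (polySum (n + 1) a) = polySum n (fun k z => (k + 1) * a (k + 1) z) := by
  ext z
  rw [dzbar_eq_of_hasFDerivAt (hasFDerivAt_polySum _ ha z), Finset.sum_range_succ', polySum]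
  simp only [Nat.cast_zero, zero_mul, mul_zero, add_zero, Nat.add_sub_cancel]
  refine Finset.sum_congr rfl fun k _ => ?_
  push_cast
  ring

theorem lap_polySum_succ (n : ℕ) {a : ℕ → ℂ → ℂ} (ha : ∀ k, Differentiable ℂ (a k)) :
    lap (polySum (n + 1) a) = polySum n (fun k z => (k + 1) * deriv (a (k + 1)) z) := by
  rw [lap, dzbar_polySum_succ n ha, dz_polySum n fun k => (ha (k + 1)).const_mul _]
  congr 1
  ext k z
  rw [deriv_const_mul _ (ha (k + 1) z)]

theorem dz_zero : dz (0 : ℂ → ℂ) = 0 := by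
  ext z
  simp [dz]

theorem dzbar_zero : dzbar (0 : ℂ → ℂ) = 0 := by
  ext z
  simp [dzbar]

theorem lap_zero : lap (0 : ℂ → ℂ) = 0 := by
  rw [lap, dzbar_zero, dz_zero]

/-- Each ∂̄ removes one power of z̄ and keeps the coefficients entire. -/
theorem dzbar_iterate_polySum {n m : ℕ} (hnm : n ≤ m) {a : ℕ → ℂ → ℂ}
    (ha : ∀ k, Differentiable ℂ (a k)) : dzbar^[m] (polySum n a) = 0 := by
  induction m generalizing n a with
  | zero =>
    obtain rfl : n = 0 := by omega
    ext z
    simp [polySum]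
  | succ m ih =>
    rw [Function.iterate_succ_apply]
    cases n with
    | zero =>
      have h0 : polySum 0 a = 0 := by
        ext z
        simp [polySum]
      rw [h0, dzbar_zero, ← h0]
      exact ih (Nat.zero_le m) ha
    | succ n =>
      rw [dzbar_polySum_succ n ha]
      exact ih (by omega) fun k => (ha (k + 1)).const_mul _

theorem differentiable_deriv {g : ℂ → ℂ} (h : Differentiable ℂ g) : Differentiable ℂ (deriv g) :=
  fun z => (h.analyticAt z).deriv.differentiableAt

theorem lap_iterate_polySum {n m : ℕ} (hnm : n ≤ m) {a : ℕ → ℂ → ℂ}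
    (ha : ∀ k, Differentiable ℂ (a k)) : lap^[m] (polySum n a) = 0 := by
  induction m generalizing n a with
  | zero =>
    obtain rfl : n = 0 := by omega
    ext z
    simp [polySum]
  | succ m ih =>
    rw [Function.iterate_succ_apply]
    cases n with
    | zero =>
      have h0 : polySum 0 a = 0 := by
        ext z
        simp [polySum]
      rw [h0, lap_zero, ← h0]
      exact ih (Nat.zero_le m) ha
    | succ n =>
      rw [lap_polySum_succ n ha]
      exact ih (by omega) fun k => (differentiable_deriv (ha (k + 1))).const_mul _

/-! ### Entire primitives and the Euler equation -/

theorem exists_entire_primitive {g : ℂ → ℂ} (hg : Differentiable ℂ g) :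
    ∃ P : ℂ → ℂ, P 0 = 0 ∧ ∀ z, HasDerivAt P (g z) z := by
  obtain ⟨P, hP, h⟩ := hg.isExactOn_univ.with_val_at 0 0
  exact ⟨P, hP, fun z => h z (Set.mem_univ z)⟩

theorem exists_entire_factor {P : ℂ → ℂ} (hP : Differentiable ℂ P) (h0 : P 0 = 0) :
    ∃ Q : ℂ → ℂ, Differentiable ℂ Q ∧ P = fun z => z * Q z := by
  refine ⟨dslope P 0, ?_, ?_⟩
  · rw [← differentiableOn_univ]
    exact (Complex.differentiableOn_dslope Filter.univ_mem).2 hP.differentiableOn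
  · ext z
    have := sub_smul_dslope P 0 z
    simp only [sub_zero, smul_eq_mul, h0] at this
    exact this.symm

/-- The Euler equation `z Q' + (k + 1) Q = A` has an entire solution for every entire `A`. -/
theorem exists_entire_euler (k : ℕ) {A : ℂ → ℂ} (hA : Differentiable ℂ A) :
    ∃ Q : ℂ → ℂ, Differentiable ℂ Q ∧ ∀ z, z * deriv Q z + (k + 1) * Q z = A z := by
  induction k generalizing A with
  | zero =>
    -- The equation reads (zQ)' = A, so Q is a primitive of A vanishing at 0, divided by z.
    obtain ⟨P, hP0, hP⟩ := exists_entire_primitive hA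
    obtain ⟨Q, hQ, rfl⟩ := exists_entire_factor (fun z => (hP z).differentiableAt) hP0
    refine ⟨Q, hQ, fun z => ?_⟩
    have := ((hasDerivAt_id z).mul (hQ z).hasDerivAt).unique (hP z)
    simp only [id, one_mul] at this
    rw [← this]
    push_cast
    ring
  | succ k ih =>
    -- Solve the previous equation with right-hand side zA. Its solution T vanishes at 0, and T = zQ
    -- gives z(zQ' + (k+2)Q) = zA; cancel z away from 0 and extend by continuity.
    obtain ⟨T, hT, hTe⟩ := ih (A := fun z => z * A z) (differentiable_id.mul hA)
    have hT0 : T 0 = 0 := by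
      have := hTe 0
      simp only [zero_mul, zero_add, mul_eq_zero] at this
      exact this.resolve_left (by exact_mod_cast k.succ_ne_zero)
    obtain ⟨Q, hQ, rfl⟩ := exists_entire_factor hT hT0
    refine ⟨Q, hQ, ?_⟩
    have hder : ∀ z, deriv (fun z => z * Q z) z = Q z + z * deriv Q z := fun z => by
      simpa using ((hasDerivAt_id' z).fun_mul (hQ z).hasDerivAt).deriv
    have hne : Set.EqOn (fun z => z * deriv Q z + ((k + 1 : ℕ) + 1) * Q z) A {0}ᶜ := by
      intro z hz
      have h1 := hTe z
      rw [hder] at h1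
      apply mul_left_cancel₀ (show z ≠ 0 from hz)
      rw [← h1]
      push_cast
      ring
    have hdc : Continuous (deriv Q) := (differentiable_deriv hQ).continuous
    have hQc := hQ.continuous
    exact congrFun (Continuous.ext_on (dense_compl_singleton 0) (by fun_prop) hA.continuous hne)

/-! ### The Almansi expansion -/

/-- A real-valued function of class `C²` with vanishing Laplacian is the real part of an
entire function. -/
theorem exists_entire_of_lap_eq_zero {w : ℂ → ℂ} (hw : ContDiff ℝ 2 w) (hre : rePart w = w)
    (h : lap w = 0) : ∃ V : ℂ → ℂ, Differentiable ℂ V ∧ w = rePart V := by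
  have hconj : (fun z => conj (w z)) = w := by
    rw [← hre]
    ext z
    simp [rePart]
  have hp : ∀ z, dz w z = conj (dzbar w z) := fun z => by
    rw [← dz_conj, hconj]
  have hp' : ∀ z, dzbar w z = conj (dz w z) := fun z => by
    rw [hp, Complex.conj_conj]
  have hpd : Differentiable ℝ (dz w) :=
    (contDiff_dz (n := 1) (by norm_num; exact hw)).differentiable (by norm_num)
  -- Since w is real, ∂w is the conjugate of ∂̄w, so ∂̄∂w is the conjugate of ∂∂̄w = 0.
  have hpe : Differentiable ℂ (dz w) := fun z => by
    refine (hasDerivAt_of_dzbar_eq_zero (hpd z) ?_).differentiableAt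
    rw [funext hp, dzbar_conj]
    have := congrFun h z
    simp only [lap, Pi.zero_apply] at this
    rw [this, map_zero]
  obtain ⟨P, -, hP⟩ := exists_entire_primitive hpe
  -- With P' = ∂w, the function P + P̄ has the same Wirtinger derivatives as w, so w - 2 Re P is
  -- constant.
  have hd : ∀ z, HasFDerivAt (fun z => w z - (P z + conj (P z))) (0 : ℂ →L[ℝ] ℂ) z := fun z => by
    have h1 := hasFDerivAt_wirtingerCLM (hw.differentiable (by norm_num) z)
    have h2 := hasFDerivAt_of_hasDerivAt (hP z)
    have h3 := (Complex.conjCLE : ℂ →L[ℝ] ℂ).hasFDerivAt.comp z h2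
    refine (h1.sub (h2.add h3)).congr_fderiv ?_
    ext v
    simp [wirtingerCLM_apply, hp' z]
  have hcst : ∀ z, w z - (P z + conj (P z)) = w 0 - (P 0 + conj (P 0)) := fun z =>
    is_const_of_fderiv_eq_zero (𝕜 := ℝ) (fun z => (hd z).differentiableAt)
      (fun z => (hd z).fderiv) z 0
  refine ⟨fun z => 2 * P z + (w 0 - (P 0 + conj (P 0))), ?_, ?_⟩
  · have : Differentiable ℂ P := fun z => (hP z).differentiableAt
    fun_prop
  · ext z
    have h1 : rePart w z = w z := congrFun hre z
    rw [rePart, ← hcst z, ← h1, rePart]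
    apply Complex.ext <;> simp
    ring

theorem rePart_polySum_succ (r : ℕ) (b : ℕ → ℂ → ℂ) (z : ℂ) :
    rePart (polySum (r + 1) b) z
      = rePart (b 0) z + rePart (polySum (r + 1) (fun k => if k = 0 then 0 else b k)) z := by
  simp [rePart, polySum, Finset.sum_range_succ', add_comm]

/-- Almansi expansion: a real-valued polyharmonic function on `ℂ` is the real part of a function
`∑_{k<r} |z|^{2k} V_k(z)` with entire `V_k`. -/
theorem exists_almansi (r : ℕ) {f : ℂ → ℂ} (hf : ContDiff ℝ (2 * r : ℕ) f) (hre : rePart f = f)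
    (h : lap^[r] f = 0) : ∃ V : ℕ → ℂ → ℂ, (∀ k, Differentiable ℂ (V k)) ∧
      f = rePart (polySum r (fun k z => z ^ k * V k z)) := by
  induction r generalizing f with
  | zero =>
    refine ⟨fun _ => 0, fun _ => differentiable_const 0, ?_⟩
    ext z
    have := congrFun h z
    simpa [rePart, polySum] using this
  | succ r ih =>
    have hf2 : ContDiff ℝ 2 f := hf.of_le (by norm_cast; omega)
    obtain ⟨V, hV, hVe⟩ := ih (f := lap f) (contDiff_lap (by exact_mod_cast hf))
      (by rw [← lap_rePart hf2, hre]) (by rw [← Function.iterate_succ_apply, h])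
    choose Q hQ hQe using fun k => exists_entire_euler k (hV k)
    -- Since ∂∂̄(z^{k+1} z̄^{k+1} Q/(k+1)) = |z|^{2k} (zQ' + (k+1)Q)/(k+1) · (k+1)/(k+1) up to the
    -- factor k+1 produced by ∂̄, the Euler equation for `Q k` makes this term a preimage of
    -- |z|^{2k} V_k.
    let b : ℕ → ℂ → ℂ := fun k z => z ^ k * ((1 / k : ℂ) * Q (k - 1) z)
    have hb : ∀ k, Differentiable ℂ (b k) := fun k => by
      have := hQ (k - 1)
      fun_prop
    let b₀ : ℕ → ℂ → ℂ := fun k => if k = 0 then 0 else b k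
    have hb₀ : ∀ k, Differentiable ℂ (b₀ k) := fun k => by
      by_cases hk : k = 0
      · simp only [b₀, hk, if_true]
        exact differentiable_const 0
      · simp only [b₀, hk, if_false]
        exact hb k
    have hlap : lap (polySum (r + 1) b₀) = polySum r (fun k z => z ^ k * V k z) := by
      rw [lap_polySum_succ r hb₀]
      congr 1
      ext k z
      have hd : HasDerivAt (b₀ (k + 1)) (((k + 1 : ℕ) * z ^ k) * ((1 / (k + 1 : ℕ) : ℂ) * Q k z)
          + z ^ (k + 1) * ((1 / (k + 1 : ℕ) : ℂ) * deriv (Q k) z)) z := by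
        simp only [b₀, Nat.succ_ne_zero, if_false, b]
        exact (hasDerivAt_pow (k + 1) z).mul (((hQ k) z).hasDerivAt.const_mul _)
      rw [hd.deriv, ← hQe k z]
      have : (k : ℂ) + 1 ≠ 0 := by exact_mod_cast k.succ_ne_zero
      push_cast
      field_simp
      ring
    have hs : ContDiff ℝ 2 (polySum (r + 1) b₀) := contDiff_polySum _ hb₀
    have hsr := contDiff_rePart hs
    -- Subtracting the real part of this preimage leaves a harmonic function, which supplies the
    -- coefficient of index 0.
    obtain ⟨V₀, hV₀, hw⟩ := exists_entire_of_lap_eq_zero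
      (w := fun z => f z + (-1) * rePart (polySum (r + 1) b₀) z)
      (hf2.add (contDiff_const.mul hsr))
      (by
        ext z
        have := congrFun hre z
        simp only [rePart] at this ⊢
        simp [this])
      (by
        rw [lap_add hf2 (contDiff_const.mul hsr), lap_const_mul _ hsr, lap_rePart hs, hlap, hVe]
        ext z
        simp)
    refine ⟨fun k => if k = 0 then V₀ else fun z => (1 / k : ℂ) * Q (k - 1) z, fun k => ?_, ?_⟩
    · by_cases hk : k = 0
      · simp only [hk, if_true]
        exact hV₀
      · simp only [hk, if_false]
        exact (hQ (k - 1)).const_mul _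
    · ext z
      rw [rePart_polySum_succ]
      have h1 := congrFun hw z
      have h2 : (fun k : ℕ => if k = 0 then (0 : ℂ → ℂ) else fun z => z ^ k *
          (if k = 0 then V₀ else fun z => (1 / k : ℂ) * Q (k - 1) z) z) = b₀ := by
        ext k z
        by_cases hk : k = 0 <;> simp [hk, b₀, b]
      rw [h2]
      have h3 : rePart (fun z => z ^ 0 * (if (0 : ℕ) = 0 then V₀ else
          fun z => (1 / (0 : ℕ) : ℂ) * Q (0 - 1) z) z) z = rePart V₀ z := by
        simp [rePart]
      rw [h3, ← h1]
      ring

/-- The entire functions of the Almansi expansion can be chosen real at the origin. -/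
theorem exists_almansi_im_eq_zero (r : ℕ) {f : ℂ → ℂ} (hf : ContDiff ℝ (2 * r : ℕ) f)
    (hre : rePart f = f) (h : lap^[r] f = 0) :
    ∃ V : ℕ → ℂ → ℂ, (∀ k, Differentiable ℂ (V k)) ∧ (∀ k, (V k 0).im = 0) ∧
      f = rePart (polySum r (fun k z => z ^ k * V k z)) := by
  obtain ⟨V, hV, rfl⟩ := exists_almansi r hf hre h
  -- An imaginary constant times the real factor |z|^{2k} does not contribute to the real part.
  refine ⟨fun k z => V k z - (V k 0).im * Complex.I, fun k => (hV k).sub_const _,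
    fun k => by simp, ?_⟩
  ext z
  simp only [rePart, polySum, Complex.re_sum]
  congr 1
  refine Finset.sum_congr rfl fun k _ => ?_
  have h1 : z ^ k * (V k z - (V k 0).im * Complex.I) * conj z ^ k
      = z ^ k * V k z * conj z ^ k - (((Complex.normSq z) ^ k * (V k 0).im : ℝ) : ℂ) * Complex.I := by
    push_cast
    rw [Complex.normSq_eq_conj_mul_self]
    ring
  rw [h1, Complex.sub_re, Complex.re_ofReal_mul, Complex.I_re, mul_zero, sub_zero]

/-! ### Smoothness of integrals depending on a parameter -/

theorem continuousOn_intervalIntegral_param {E F : Type} [NormedAddCommGroup E]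
    [NormedAddCommGroup F] [NormedSpace ℝ F] {U : Set E} {f : E × ℝ → F}
    (hf : ContinuousOn f (U ×ˢ Set.univ)) (a b : ℝ) :
    ContinuousOn (fun x => ∫ t in a..b, f (x, t)) U := by
  rw [continuousOn_iff_continuous_domRestrict]
  refine intervalIntegral.continuous_parametric_intervalIntegral_of_continuous'
    (f := fun (x : U) t => f (x, t)) ?_ a b
  exact hf.comp_continuous (by fun_prop) fun x => ⟨x.1.2, Set.mem_univ _⟩

theorem hasFDerivAt_intervalIntegral_param {E F : Type} [NormedAddCommGroup E] [NormedSpace ℝ E]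
    [ProperSpace E] [NormedAddCommGroup F] [NormedSpace ℝ F] {U : Set E} (hU : IsOpen U)
    {f : E × ℝ → F} (hf : ContDiffOn ℝ 1 f (U ×ˢ Set.univ)) (a b : ℝ) {x₀ : E} (hx₀ : x₀ ∈ U) :
    HasFDerivAt (fun x => ∫ t in a..b, f (x, t))
      (∫ t in a..b, (fderiv ℝ f (x₀, t)).comp (ContinuousLinearMap.inl ℝ E ℝ)) x₀ := by
  have hUo : IsOpen (U ×ˢ (Set.univ : Set ℝ)) := hU.prod isOpen_univ
  have hf' : ContinuousOn (fun q => (fderiv ℝ f q).comp (ContinuousLinearMap.inl ℝ E ℝ))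
      (U ×ˢ Set.univ) :=
    (hf.continuousOn_fderiv_of_isOpen hUo le_rfl).clm_comp continuousOn_const
  have hc : ∀ x ∈ U, Continuous fun t => f (x, t) := fun x hx =>
    hf.continuousOn.comp_continuous (by fun_prop) fun t => ⟨hx, Set.mem_univ _⟩
  -- The constant dominating the derivative comes from compactness of a closed ball times the
  -- interval of integration.
  obtain ⟨ε, hε, hball⟩ := Metric.nhds_basis_closedBall.mem_iff.1 (hU.mem_nhds hx₀)
  obtain ⟨C, hC⟩ := ((isCompact_closedBall x₀ ε).prod (isCompact_uIcc (a := a) (b := b)))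
    |>.exists_bound_of_continuousOn (hf'.mono (Set.prod_mono hball (Set.subset_univ _)))
  refine intervalIntegral.hasFDerivAt_integral_of_dominated_of_fderiv_le
    (F := fun x t => f (x, t))
    (F' := fun x t => (fderiv ℝ f (x, t)).comp (ContinuousLinearMap.inl ℝ E ℝ))
    (s := Metric.closedBall x₀ ε) (bound := fun _ => C)
    (Metric.closedBall_mem_nhds x₀ hε) ?_ ((hc x₀ hx₀).intervalIntegrable a b) ?_ ?_
    intervalIntegrable_const ?_
  · filter_upwards [hU.mem_nhds hx₀] with x hx
    exact (hc x hx).aestronglyMeasurable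
  · exact (hf'.comp_continuous (f := fun t : ℝ => (x₀, t)) (by fun_prop)
      fun t => ⟨hx₀, Set.mem_univ _⟩).aestronglyMeasurable
  · exact Filter.Eventually.of_forall fun t ht x hx => hC (x, t) ⟨hx, Set.uIoc_subset_uIcc ht⟩
  · refine Filter.Eventually.of_forall fun t _ x hx => ?_
    have h1 : HasFDerivAt f (fderiv ℝ f (x, t)) (x, t) :=
      ((hf.differentiableOn (by norm_num)).differentiableAt
        (hUo.mem_nhds ⟨hball hx, Set.mem_univ _⟩)).hasFDerivAt
    exact h1.comp x (hasFDerivAt_prodMk_left x t)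

/-- The derivative is again a parametric integral, now with values in a space of continuous linear
maps; hence the induction varies `F`. -/
theorem contDiffOn_intervalIntegral_param {E F : Type} [NormedAddCommGroup E] [NormedSpace ℝ E]
    [ProperSpace E] [NormedAddCommGroup F] [NormedSpace ℝ F] {U : Set E} (hU : IsOpen U) (n : ℕ)
    {f : E × ℝ → F} (hf : ContDiffOn ℝ n f (U ×ˢ Set.univ)) (a b : ℝ) :
    ContDiffOn ℝ n (fun x => ∫ t in a..b, f (x, t)) U := by
  induction n generalizing F with
  | zero =>
    simp only [Nat.cast_zero, contDiffOn_zero] at hf ⊢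
    exact continuousOn_intervalIntegral_param hf a b
  | succ n ih =>
    push_cast at hf ⊢
    have hf1 : ContDiffOn ℝ 1 f (U ×ˢ Set.univ) := hf.of_le (by norm_cast; omega)
    have hd := fun x hx => hasFDerivAt_intervalIntegral_param hU hf1 a b (x₀ := x) hx
    rw [contDiffOn_succ_iff_fderiv_of_isOpen hU]
    refine ⟨fun x hx => (hd x hx).differentiableAt.differentiableWithinAt, by simp, ?_⟩
    refine ContDiffOn.congr ?_ fun x hx => (hd x hx).fderiv
    refine ih (f := fun q => (fderiv ℝ f q).comp (ContinuousLinearMap.inl ℝ E ℝ)) ?_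
    exact (hf.fderiv_of_isOpen (hU.prod isOpen_univ) le_rfl).clm_comp contDiffOn_const

/-! ### The Schwarz integral -/

/-- The Schwarz integral of `f` over the circle of radius `R` around the origin. -/
def schwarz (R : ℝ) (f : ℂ → ℂ) (z : ℂ) : ℂ :=
  -- The kernel is (ζ + z)/(ζ - z), split so that the Cauchy kernel ζ/(ζ - z) appears.
  Real.circleAverage (fun ζ => (2 * (ζ / (ζ - z)) - 1) * f ζ) 0 R

theorem norm_circleMap_zero' {R : ℝ} (hR : 0 < R) (θ : ℝ) : ‖circleMap 0 R θ‖ = R := by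
  rw [norm_circleMap_zero, abs_of_pos hR]

theorem circleMap_sub_ne_zero {R : ℝ} {z : ℂ} (hz : ‖z‖ < R) (θ : ℝ) :
    circleMap 0 R θ - z ≠ 0 := by
  intro h
  have h1 := norm_circleMap_zero' ((norm_nonneg z).trans_lt hz) θ
  rw [sub_eq_zero.1 h] at h1
  exact hz.ne h1

theorem contDiffOn_schwarz (n : ℕ) {f : ℂ × ℂ → ℂ} (hf : ContDiff ℝ n f) (R : ℝ) :
    ContDiffOn ℝ n (fun p : ℂ × ℂ => schwarz R (fun α => f (α, p.2)) p.1)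
      (Metric.ball 0 R ×ˢ Set.univ) := by
  simp only [schwarz, Real.circleAverage]
  refine ContDiffOn.const_smul _ (contDiffOn_intervalIntegral_param
    (Metric.isOpen_ball.prod isOpen_univ) n (f := fun q : (ℂ × ℂ) × ℝ =>
      (2 * (circleMap 0 R q.2 / (circleMap 0 R q.2 - q.1.1)) - 1)
        * f (circleMap 0 R q.2, q.1.2)) ?_ _ _)
  have hcm : ContDiff ℝ n (fun q : (ℂ × ℂ) × ℝ => circleMap 0 R q.2) :=
    (contDiff_circleMap 0 R).comp contDiff_snd
  have hden : ContDiff ℝ n (fun q : (ℂ × ℂ) × ℝ => circleMap 0 R q.2 - q.1.1) :=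
    hcm.sub (contDiff_fst.comp contDiff_fst)
  simp only [div_eq_mul_inv]
  refine ContDiffOn.mul ((contDiffOn_const.mul (hcm.contDiffOn.mul
    (hden.contDiffOn.inv ?_))).sub contDiffOn_const) ?_
  · rintro ⟨⟨z, p⟩, t⟩ ⟨⟨hz, -⟩, -⟩
    exact circleMap_sub_ne_zero (by simpa using hz) t
  · exact (hf.comp (hcm.prodMk (contDiff_snd.comp contDiff_fst))).contDiffOn

/-- The Schwarz formula recovers an entire function, real at the origin, from its real part. -/
theorem schwarz_rePart {V : ℂ → ℂ} (hV : Differentiable ℂ V) (h0 : (V 0).im = 0) {R : ℝ} {z : ℂ}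
    (hz : ‖z‖ < R) : schwarz R (rePart V) z = V z := by
  have hR : 0 < R := (norm_nonneg z).trans_lt hz
  have hVc := hV.continuous
  have hcm : Continuous (circleMap 0 R) := continuous_circleMap 0 R
  have hne := circleMap_sub_ne_zero hz
  have hden : ∀ ζ ∈ Metric.closedBall (0 : ℂ) R, (R : ℂ) ^ 2 - conj z * ζ ≠ 0 := by
    intro ζ hζ h
    have h1 : (R : ℝ) ^ 2 = ‖z‖ * ‖ζ‖ := by
      have := congrArg norm (sub_eq_zero.1 h)
      simpa [abs_of_pos hR] using this
    have h2 : ‖ζ‖ ≤ R := by simpa using hζ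
    nlinarith [norm_nonneg z, norm_nonneg ζ]
  have e1 : Real.circleAverage (fun ζ => ζ / (ζ - z) * V ζ) 0 R = V z := by
    have := DiffContOnCl.circleAverage_smul_div (f := V) (c := 0) (R := R) (w := z)
      hV.diffContOnCl (by simpa [abs_of_pos hR] using hz)
    simpa using this
  have e2 : Real.circleAverage V 0 R = V 0 := hV.diffContOnCl.circleAverage
  -- On the circle this kernel is the conjugate of ζ/(ζ - z), but it is holomorphic on the closed
  -- disc, so the mean value property applies.
  have e3 : Real.circleAverage (fun ζ => (R : ℂ) ^ 2 / ((R : ℂ) ^ 2 - conj z * ζ) * V ζ) 0 R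
      = V 0 := by
    have hd : DifferentiableOn ℂ (fun ζ => (R : ℂ) ^ 2 / ((R : ℂ) ^ 2 - conj z * ζ) * V ζ)
        (Metric.closedBall 0 R) :=
      ((differentiableOn_const _).div (by fun_prop) hden).mul hV.differentiableOn
    have := DiffContOnCl.circleAverage (c := 0) (R := R)
      (f := fun ζ => (R : ℂ) ^ 2 / ((R : ℂ) ^ 2 - conj z * ζ) * V ζ)
      (by
        rw [abs_of_pos hR]
        exact hd.diffContOnCl_ball subset_rfl)
    rw [this]
    have : (R : ℂ) ≠ 0 := by exact_mod_cast hR.ne'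
    field_simp
    simp
  have hconj : ∀ g : ℂ → ℂ, Real.circleAverage (fun ζ => conj (g ζ)) 0 R
      = conj (Real.circleAverage g 0 R) := by
    intro g
    simp only [Real.circleAverage, Complex.real_smul, map_mul, Complex.conj_ofReal]
    congr 1
    simp only [intervalIntegral.integral_of_le Real.two_pi_pos.le]
    exact integral_conj
  have hk : ∀ θ, conj (circleMap 0 R θ / (circleMap 0 R θ - z))
      = (R : ℂ) ^ 2 / ((R : ℂ) ^ 2 - conj z * circleMap 0 R θ) := by
    intro θ
    have hζ : circleMap 0 R θ * conj (circleMap 0 R θ) = (R : ℂ) ^ 2 := by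
      rw [Complex.mul_conj, Complex.normSq_eq_norm_sq, norm_circleMap_zero' hR]
      push_cast
      rfl
    have hd1 : conj (circleMap 0 R θ) - conj z ≠ 0 := by
      rw [← map_sub]
      exact (map_ne_zero _).2 (hne θ)
    have hd2 := hden (circleMap 0 R θ) (by simp [abs_of_pos hR])
    rw [map_div₀, map_sub, div_eq_div_iff hd1 hd2, ← hζ]
    ring
  have hint : ∀ g : ℂ → ℂ, Continuous (fun θ => g (circleMap 0 R θ)) → CircleIntegrable g 0 R :=
    fun g hg => hg.intervalIntegrable _ _
  have c1 : CircleIntegrable (fun ζ => ζ / (ζ - z) * V ζ) 0 R :=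
    hint _ ((hcm.div (by fun_prop) hne).mul (by fun_prop))
  have c2 : CircleIntegrable (fun ζ => ζ / (ζ - z) * conj (V ζ)) 0 R :=
    hint _ ((hcm.div (by fun_prop) hne).mul (Complex.continuous_conj.comp (by fun_prop)))
  have c3 : CircleIntegrable V 0 R := hint _ (by fun_prop)
  have c4 : CircleIntegrable (fun ζ => conj (V ζ)) 0 R :=
    hint _ (Complex.continuous_conj.comp (by fun_prop))
  have e4 : Real.circleAverage (fun ζ => ζ / (ζ - z) * conj (V ζ)) 0 R = V 0 := by
    have : Real.circleAverage (fun ζ => ζ / (ζ - z) * conj (V ζ)) 0 R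
        = Real.circleAverage (fun ζ =>
          conj ((R : ℂ) ^ 2 / ((R : ℂ) ^ 2 - conj z * ζ) * V ζ)) 0 R := by
      simp only [Real.circleAverage]
      congr 2
      ext θ
      rw [map_mul, ← hk, Complex.conj_conj]
    rw [this, hconj, e3]
    exact Complex.conj_eq_iff_im.2 h0
  have e5 : Real.circleAverage (fun ζ => conj (V ζ)) 0 R = V 0 := by
    rw [hconj, e2]
    exact Complex.conj_eq_iff_im.2 h0
  -- With Re V = (V + V̄)/2 and V(0) real, the averages add up to V(z) + V(0) - (V(0) + V(0))/2 =
  -- V(z).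
  have hsum : (fun ζ => (2 * (ζ / (ζ - z)) - 1) * rePart V ζ)
      = (fun ζ => ζ / (ζ - z) * V ζ) + (fun ζ => ζ / (ζ - z) * conj (V ζ))
        - (1 / 2 : ℂ) • (V + fun ζ => conj (V ζ)) := by
    ext ζ
    rw [rePart_eq]
    simp only [Pi.add_apply, Pi.sub_apply, Pi.smul_apply, smul_eq_mul]
    ring
  rw [schwarz, hsum, Real.circleAverage_sub (c1.add c2) ((c3.add c4).const_smul),
    Real.circleAverage_add c1 c2, Real.circleAverage_smul, Real.circleAverage_add c3 c4,
    e1, e2, e4, e5]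
  simp only [smul_eq_mul]
  ring

/-- On |ζ| = R the factor |ζ|^{2k} is the constant R^{2k}, so the boundary values are those of the
real part of an entire function, real at the origin. -/
theorem schwarz_almansi {r : ℕ} {V : ℕ → ℂ → ℂ} (hV : ∀ k, Differentiable ℂ (V k))
    (h0 : ∀ k, (V k 0).im = 0) {R : ℝ} {z : ℂ} (hz : ‖z‖ < R) :
    schwarz R (rePart (polySum r fun k z => z ^ k * V k z)) z
      = ∑ k ∈ Finset.range r, ((R : ℂ) ^ 2) ^ k * V k z := by
  have hR : 0 < R := (norm_nonneg z).trans_lt hz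
  rw [← schwarz_rePart (V := fun z => ∑ k ∈ Finset.range r, ((R : ℂ) ^ 2) ^ k * V k z) ?_ ?_ hz]
  · refine Real.circleAverage_congr_sphere fun ζ hζ => ?_
    have hn : ζ * conj ζ = (R : ℂ) ^ 2 := by
      rw [Complex.mul_conj, Complex.normSq_eq_norm_sq]
      have : ‖ζ‖ = R := by simpa [abs_of_pos hR] using hζ
      rw [this]
      push_cast
      rfl
    have : polySum r (fun k z => z ^ k * V k z) ζ
        = ∑ k ∈ Finset.range r, ((R : ℂ) ^ 2) ^ k * V k ζ := by
      rw [polySum]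
      refine Finset.sum_congr rfl fun k _ => ?_
      rw [← hn]
      ring
    simp only [rePart, this]
  · exact Differentiable.fun_sum fun k _ => (hV k).const_mul _
  · rw [Complex.im_sum]
    refine Finset.sum_eq_zero fun k _ => ?_
    have : ((R : ℂ) ^ 2) ^ k = (((R ^ 2) ^ k : ℝ) : ℂ) := by
      push_cast
      rfl
    rw [this, Complex.im_ofReal_mul, h0, mul_zero]

/-! ### Smooth dependence of the Almansi coefficients -/

/-- Coefficients recovering the `k`-th coefficient of a polynomial of degree `< r` from its values
at `r` distinct points. -/
theorem exists_interpolation_weights {r : ℕ} {x : Fin r → ℂ} (hx : Function.Injective x)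
    (k : Fin r) : ∃ c : Fin r → ℂ, ∀ v : Fin r → ℂ,
      ∑ j, c j * ∑ i : Fin r, x j ^ (i : ℕ) * v i = v k := by
  have hdet : IsUnit (Matrix.vandermonde x).det :=
    (Matrix.det_vandermonde_ne_zero_iff.2 hx).isUnit
  refine ⟨(Matrix.vandermonde x)⁻¹ k, fun v => ?_⟩
  have h : ((Matrix.vandermonde x)⁻¹.mulVec ((Matrix.vandermonde x).mulVec v)) k = v k := by
    rw [Matrix.mulVec_mulVec, Matrix.nonsing_inv_mul _ hdet, Matrix.one_mulVec]
  simpa only [Matrix.mulVec, dotProduct, Matrix.vandermonde_apply] using h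

/-- The functions of the Almansi expansion depend on a parameter as smoothly as the expanded
function does. -/
theorem contDiff_almansi {r n : ℕ} {f : ℂ × ℂ → ℂ} (hf : ContDiff ℝ n f) {V : ℂ → ℕ → ℂ → ℂ}
    (hV : ∀ β k, Differentiable ℂ (V β k)) (h0 : ∀ β k, (V β k 0).im = 0)
    (hfV : ∀ β, (fun α => f (α, β)) = rePart (polySum r fun k z => z ^ k * V β k z))
    {k : ℕ} (hk : k < r) : ContDiff ℝ n (fun p : ℂ × ℂ => V p.2 k p.1) := by
  rw [contDiff_iff_contDiffAt]
  rintro ⟨z₀, β₀⟩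
  -- All circles enclose the disc of radius ‖z₀‖ + 1, a neighbourhood of z₀, and the squared radii
  -- are distinct interpolation nodes.
  let R : Fin r → ℝ := fun j => ‖z₀‖ + 1 + j
  have hRpos : ∀ j, 0 < R j := fun j => by positivity
  have hinj : Function.Injective fun j => ((R j : ℂ) ^ 2) := by
    intro i j hij
    have h1 : R i ^ 2 = R j ^ 2 := by
      simp only at hij
      exact_mod_cast hij
    have h2 : R i = R j := (sq_eq_sq₀ (hRpos i).le (hRpos j).le).1 h1
    have h3 : ((i : ℕ) : ℝ) = (j : ℕ) := add_left_cancel h2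
    exact Fin.ext (by exact_mod_cast h3)
  obtain ⟨c, hc⟩ := exists_interpolation_weights hinj ⟨k, hk⟩
  have hz₀ : ∀ j, ‖z₀‖ + 1 ≤ R j := fun j => by simp [R]
  have hS : ∀ j, ContDiffAt ℝ n (fun p : ℂ × ℂ => schwarz (R j) (fun α => f (α, p.2)) p.1)
      (z₀, β₀) := fun j =>
    (contDiffOn_schwarz n hf (R j)).contDiffAt
      ((Metric.isOpen_ball.prod isOpen_univ).mem_nhds
        ⟨by simpa using (lt_add_one _).trans_le (hz₀ j), Set.mem_univ _⟩)
  have hsum : ContDiffAt ℝ n (fun p : ℂ × ℂ =>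
      ∑ j, c j * schwarz (R j) (fun α => f (α, p.2)) p.1) (z₀, β₀) :=
    ContDiffAt.sum fun j _ => contDiffAt_const.mul (hS j)
  refine hsum.congr_of_eventuallyEq ?_
  have hnhd : Metric.ball (0 : ℂ) (‖z₀‖ + 1) ×ˢ (Set.univ : Set ℂ) ∈ nhds (z₀, β₀) :=
    (Metric.isOpen_ball.prod isOpen_univ).mem_nhds ⟨by simp, Set.mem_univ _⟩
  filter_upwards [hnhd] with p hp
  have hp1 : ‖p.1‖ < ‖z₀‖ + 1 := by simpa using hp.1
  have := hc fun i => V p.2 i p.1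
  rw [← this]
  refine Finset.sum_congr rfl fun j _ => ?_
  rw [hfV, schwarz_almansi (hV p.2) (h0 p.2) (hp1.trans_le (hz₀ j)),
    Finset.sum_range fun i => ((R j : ℂ) ^ 2) ^ i * V p.2 i p.1]

/-! ### Polyanalytic functions of exact order with prescribed real part -/

theorem polyanalytic_eq_polySum {r : ℕ} {g : ℂ → ℂ} (hg : g ∈ polyanalytic r) :
    ∃ a : ℕ → ℂ → ℂ, (∀ k, Differentiable ℂ (a k)) ∧ g = polySum r a := by
  obtain ⟨a, ha, -, h⟩ := hg
  exact ⟨a, ha, funext h⟩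

/-- A real-valued function of class `C^n`, polyharmonic in the first variable, is the real part of
a function of class `C^n` which is polyanalytic of exact order `r` in the first variable. -/
theorem exists_polyanalytic_rePart_eq {r n : ℕ} (hr : 0 < r) (hn : 2 * r ≤ n) {f : ℂ × ℂ → ℂ}
    (hf : ContDiff ℝ n f) (hre : ∀ p, (f p).im = 0)
    (hlap : ∀ β, lap^[r] (fun α => f (α, β)) = 0) :
    ∃ φ : ℂ → ℂ → ℂ, ContDiff ℝ n (fun p : ℂ × ℂ => φ p.2 p.1) ∧
      (∀ β, φ β ∈ polyanalytic r) ∧ ∀ β, rePart (φ β) = fun α => f (α, β) := by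
  have hfβ : ∀ β, ContDiff ℝ (2 * r : ℕ) fun α => f (α, β) := fun β =>
    (hf.of_le (by exact_mod_cast hn)).comp (contDiff_prodMk_left β)
  have hreβ : ∀ β, rePart (fun α => f (α, β)) = fun α => f (α, β) := fun β => by
    ext α
    apply Complex.ext <;> simp [rePart, hre]
  choose V hV h0 hfV using fun β => exists_almansi_im_eq_zero r (hfβ β) (hreβ β) (hlap β)
  have hVc := fun k hk => contDiff_almansi hf hV h0 hfV (k := k) hk
  obtain ⟨s, rfl⟩ : ∃ s, r = s + 1 := ⟨r - 1, by omega⟩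
  -- The added i in the top coefficient forces exact order `r` for every β; it contributes only
  -- i|z|^{2s}, which is purely imaginary.
  let a : ℂ → ℕ → ℂ → ℂ := fun β k z => z ^ k * (V β k z + if k = s then Complex.I else 0)
  refine ⟨fun β => polySum (s + 1) (a β), ?_, fun β => ⟨a β, fun k => ?_, fun _ h => ?_,
    fun z => rfl⟩, fun β => ?_⟩
  · unfold polySum
    refine ContDiff.sum fun k hk => ?_
    refine ((contDiff_fst.pow k).mul ((hVc k (Finset.mem_range.1 hk)).add contDiff_const)).mul ?_
    exact (Complex.conjCLE.contDiff.comp contDiff_fst).pow k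
  · have := hV β k
    fun_prop
  · have hc : ∀ z ∈ ({0}ᶜ : Set ℂ), V β s z + Complex.I = 0 := fun z hz => by
      have h1 := congrFun h z
      simp only [a, Nat.add_sub_cancel, if_true, Pi.zero_apply, mul_eq_zero] at h1
      exact h1.resolve_left (pow_ne_zero _ hz)
    have h2 : V β s 0 + Complex.I = 0 :=
      congrFun (Continuous.ext_on (dense_compl_singleton (0 : ℂ))
        ((hV β s).continuous.add continuous_const) continuous_const hc) 0
    have h3 := congrArg Complex.im h2
    simp [h0] at h3
  · rw [hfV]
    ext z
    simp only [rePart, polySum, a, Complex.re_sum]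
    congr 1
    refine Finset.sum_congr rfl fun k _ => ?_
    split_ifs
    · have h1 : z ^ k * (V β k z + Complex.I) * conj z ^ k
          = z ^ k * V β k z * conj z ^ k + ((Complex.normSq z ^ k : ℝ) : ℂ) * Complex.I := by
        push_cast
        rw [Complex.normSq_eq_conj_mul_self]
        ring
      rw [h1, Complex.add_re, Complex.re_ofReal_mul, Complex.I_re, mul_zero, add_zero]
    · rw [add_zero]

theorem lap_iterate_polyanalytic {r m : ℕ} (h : r ≤ m) {g : ℂ → ℂ} (hg : g ∈ polyanalytic r) :
    lap^[m] g = 0 := by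
  obtain ⟨a, ha, rfl⟩ := polyanalytic_eq_polySum hg
  exact lap_iterate_polySum h ha

theorem dzbar_iterate_polyanalytic {r m : ℕ} (h : r ≤ m) {g : ℂ → ℂ} (hg : g ∈ polyanalytic r) :
    dzbar^[m] g = 0 := by
  obtain ⟨a, ha, rfl⟩ := polyanalytic_eq_polySum hg
  exact dzbar_iterate_polySum h ha

/-- Polyanalytic functions are smooth, so `k` is unrestricted; this transfers vanishing from G to F
at any order. -/
theorem lap_iterate_rePart_polyanalytic {r : ℕ} (k : ℕ) {g : ℂ → ℂ} (hg : g ∈ polyanalytic r) :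
    lap^[k] (rePart g) = rePart (lap^[k] g) := by
  obtain ⟨a, ha, rfl⟩ := polyanalytic_eq_polySum hg
  exact lap_iterate_rePart k (contDiff_polySum r ha)

/-! ### Reduction of the bicomplex operators to one-variable slices -/

theorem lapAlpha_iterate_idem (k : ℕ) (f : BC → ℂ) (α β : ℂ) :
    lapAlpha^[k] f (idem α β) = lap^[k] (fun w => f (idem w β)) α := by
  induction k generalizing f with
  | zero => rfl
  | succ k ih =>
    rw [Function.iterate_succ_apply, Function.iterate_succ_apply, ih]
    have h : (fun w => lapAlpha f (idem w β)) = lap (fun w => f (idem w β)) := by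
      ext w
      simp [lapAlpha, lap, dAlpha, dAlphaBar]
    rw [h]

theorem lapBeta_iterate_idem (k : ℕ) (f : BC → ℂ) (α β : ℂ) :
    lapBeta^[k] f (idem α β) = lap^[k] (fun w => f (idem α w)) β := by
  induction k generalizing f with
  | zero => rfl
  | succ k ih =>
    rw [Function.iterate_succ_apply, Function.iterate_succ_apply, ih]
    have h : (fun w => lapBeta f (idem α w)) = lap (fun w => f (idem α w)) := by
      ext w
      simp [lapBeta, lap, dBeta, dBetaBar]
    rw [h]

theorem lapBC_iterate_idem (k : ℕ) (F : BC → BC) (α β : ℂ) :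
    lapBC^[k] F (idem α β) = idem (lap^[k] (fun w => plus (F (idem w β))) α)
      (lap^[k] (fun w => minus (F (idem α w))) β) := by
  induction k generalizing F with
  | zero => simp
  | succ k ih =>
    rw [Function.iterate_succ_apply, Function.iterate_succ_apply, Function.iterate_succ_apply, ih]
    have h₁ : (fun w => plus (lapBC F (idem w β))) = lap (fun w => plus (F (idem w β))) := by
      ext w
      simp [lapBC_apply, lapAlpha, lap, dAlpha, dAlphaBar]
    have h₂ : (fun w => minus (lapBC F (idem α w))) = lap (fun w => minus (F (idem α w))) := by
      ext w
      simp [lapBC_apply, lapBeta, lap, dBeta, dBetaBar]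
    rw [h₁, h₂]

theorem dZstar_iterate_idem (k : ℕ) (F : BC → BC) (α β : ℂ) :
    dZstar^[k] F (idem α β) = idem (dzbar^[k] (fun w => plus (F (idem w β))) α)
      (dzbar^[k] (fun w => minus (F (idem α w))) β) := by
  induction k generalizing F with
  | zero => simp
  | succ k ih =>
    rw [Function.iterate_succ_apply, Function.iterate_succ_apply, Function.iterate_succ_apply, ih]
    have h₁ : (fun w => plus (dZstar F (idem w β))) = dzbar (fun w => plus (F (idem w β))) := by
      ext w
      simp [dZstar, dAlphaBar]
    have h₂ : (fun w => minus (dZstar F (idem α w))) = dzbar (fun w => minus (F (idem α w))) := by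
      ext w
      simp [dZstar, dBetaBar]
    rw [h₁, h₂]

theorem idem_zero : idem 0 0 = 0 := by
  simp [idem]

theorem idem_eq_zero_iff {α β : ℂ} : idem α β = 0 ↔ α = 0 ∧ β = 0 := by
  refine ⟨fun h => ⟨?_, ?_⟩, ?_⟩
  · rw [← plus_idem α β, h, ← idem_zero, plus_idem]
  · rw [← minus_idem α β, h, ← idem_zero, minus_idem]
  · rintro ⟨rfl, rfl⟩
    exact idem_zero

theorem eq_zero_iff_forall_idem {M : Type} [Zero M] {f : BC → M} :
    f = 0 ↔ ∀ α β, f (idem α β) = 0 := by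
  refine ⟨fun h α β => by rw [h]; rfl, fun h => funext fun Z => ?_⟩
  rw [← idem_plus_minus Z]
  exact h _ _

theorem lapBC_iterate_eq_zero_iff (k : ℕ) (F : BC → BC) :
    lapBC^[k] F = 0 ↔ lapAlpha^[k] (fun Z => plus (F Z)) = 0 ∧
      lapBeta^[k] (fun Z => minus (F Z)) = 0 := by
  simp only [eq_zero_iff_forall_idem, lapBC_iterate_idem, lapAlpha_iterate_idem,
    lapBeta_iterate_idem, idem_eq_zero_iff, forall_and]

theorem lap_iterate_zero (k : ℕ) : lap^[k] 0 = 0 :=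
  Function.iterate_fixed lap_zero k

theorem lap_iterate_eq_zero_of_le {r k : ℕ} (h : r ≤ k) {g : ℂ → ℂ} (hg : lap^[r] g = 0) :
    lap^[k] g = 0 := by
  obtain ⟨d, rfl⟩ := Nat.exists_eq_add_of_le' h
  rw [Function.iterate_add_apply, hg, lap_iterate_zero]

theorem lapAlpha_iterate_eq_zero_iff {k : ℕ} {f : BC → ℂ} :
    lapAlpha^[k] f = 0 ↔ ∀ β, lap^[k] (fun w => f (idem w β)) = 0 := by
  rw [eq_zero_iff_forall_idem, forall_comm]
  simp only [lapAlpha_iterate_idem, funext_iff, Pi.zero_apply]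

theorem lapBeta_iterate_eq_zero_iff {k : ℕ} {f : BC → ℂ} :
    lapBeta^[k] f = 0 ↔ ∀ α, lap^[k] (fun w => f (idem α w)) = 0 := by
  rw [eq_zero_iff_forall_idem]
  simp only [lapBeta_iterate_idem, funext_iff, Pi.zero_apply]

/-- The passage between (z₁, z₂) and (α, β) is an invertible linear change of coordinates, on the
source and on the target. -/
theorem isCn_iff_idem (n : ℕ) (F : BC → BC) :
    IsCn n F ↔ ContDiff ℝ n (fun p : ℂ × ℂ => plus (F (idem p.1 p.2))) ∧
      ContDiff ℝ n (fun p : ℂ × ℂ => minus (F (idem p.1 p.2))) := by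
  have hre : ∀ p : ℂ × ℂ, idem p.1 p.2
      = ⟨(p.1 + p.2) / 2, Complex.I * (p.1 - p.2) / 2⟩ := fun p => by
    ext <;> simp [idem, ePlus, eMinus, kUnit, one_re, one_im] <;> ring
  have hre' : ∀ p : ℂ × ℂ, (⟨p.1, p.2⟩ : BC)
      = idem (p.1 - Complex.I * p.2) (p.1 + Complex.I * p.2) := fun p =>
    (idem_plus_minus ⟨p.1, p.2⟩).symm
  constructor
  · intro h
    have h1 : ContDiff ℝ n (fun p : ℂ × ℂ => ((F (idem p.1 p.2)).re, (F (idem p.1 p.2)).im)) := by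
      simp only [hre]
      exact h.comp (g := fun p : ℂ × ℂ => ((F ⟨p.1, p.2⟩).re, (F ⟨p.1, p.2⟩).im))
        (f := fun p : ℂ × ℂ => ((p.1 + p.2) / 2, Complex.I * (p.1 - p.2) / 2)) (by fun_prop)
    exact ⟨h1.fst.sub (contDiff_const.mul h1.snd), h1.fst.add (contDiff_const.mul h1.snd)⟩
  · rintro ⟨h1, h2⟩
    have hc : ContDiff ℝ n (fun p : ℂ × ℂ => (p.1 - Complex.I * p.2, p.1 + Complex.I * p.2)) := by
      fun_prop
    have h1' := h1.comp hc
    have h2' := h2.comp hc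
    have hF : ∀ Z : BC, Z.re = (plus Z + minus Z) / 2 ∧
        Z.im = Complex.I * (plus Z - minus Z) / 2 := fun Z => by
      constructor
      · simp [plus, minus]
      · simp only [plus, minus]
        linear_combination Z.im * Complex.I_mul_I
    unfold IsCn
    simp only [hF, hre']
    simp only [Function.comp_def] at h1' h2'
    exact ((h1'.add h2').div_const 2).prodMk ((contDiff_const.mul (h1'.sub h2')).div_const 2)

theorem im_plus_eq_zero {Z : BC} (h : Z ∈ hyperbolic) : (plus Z).im = 0 := by
  obtain ⟨x, y, rfl⟩ := h
  simp [plus, kUnit, one_re, one_im]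

theorem im_minus_eq_zero {Z : BC} (h : Z ∈ hyperbolic) : (minus Z).im = 0 := by
  obtain ⟨x, y, rfl⟩ := h
  simp [minus, kUnit, one_re, one_im]

end Bicomplex

end

/-! ### The main theorem -/

theorem lemma5p3 (m : ℕ) (F : Bicomplex.BC → Bicomplex.BC)
    (hF : ∀ Z, F Z ∈ Bicomplex.hyperbolic) (hm : Bicomplex.IsPolyharmonic m F) :
    ∃ r s : ℕ, m = max r s ∧
      IsLeast {k : ℕ | 0 < k ∧ Bicomplex.lapAlpha^[k] (fun Z => Bicomplex.plus (F Z)) = 0} r ∧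
      IsLeast {k : ℕ | 0 < k ∧ Bicomplex.lapBeta^[k] (fun Z => Bicomplex.minus (F Z)) = 0} s ∧
      ∃ (φ ψ : ℂ → ℂ → ℂ) (G : Bicomplex.BC → Bicomplex.BC),
        (∀ β, φ β ∈ Bicomplex.polyanalytic r) ∧
        (∀ α, ψ α ∈ Bicomplex.polyanalytic s) ∧
        (∀ α β, G (Bicomplex.idem α β) = Bicomplex.idem (φ β α) (ψ α β)) ∧
        (∀ Z, Bicomplex.reHyp (G Z) = F Z) ∧
        Bicomplex.IsPolyharmonic m G ∧
        Bicomplex.dZstar^[m] G = 0 := by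
  open Bicomplex in
  obtain ⟨hC, ⟨hm0, hmF⟩, hmin⟩ := hm
  obtain ⟨hCp, hCm⟩ := (isCn_iff_idem _ _).1 hC
  obtain ⟨hA, hB⟩ := (lapBC_iterate_eq_zero_iff m F).1 hmF
  classical
  have hexr : ∃ k, 0 < k ∧ lapAlpha^[k] (fun Z => plus (F Z)) = 0 := ⟨m, hm0, hA⟩
  have hexs : ∃ k, 0 < k ∧ lapBeta^[k] (fun Z => minus (F Z)) = 0 := ⟨m, hm0, hB⟩
  obtain ⟨r, ⟨hr0, hrF⟩, hrmin⟩ : ∃ r, IsLeast {k : ℕ | 0 < k ∧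
      lapAlpha^[k] (fun Z => plus (F Z)) = 0} r :=
    ⟨Nat.find hexr, Nat.find_spec hexr, fun k hk => Nat.find_min' hexr hk⟩
  obtain ⟨s, ⟨hs0, hsF⟩, hsmin⟩ : ∃ s, IsLeast {k : ℕ | 0 < k ∧
      lapBeta^[k] (fun Z => minus (F Z)) = 0} s :=
    ⟨Nat.find hexs, Nat.find_spec hexs, fun k hk => Nat.find_min' hexs hk⟩
  have hrm : r ≤ m := hrmin ⟨hm0, hA⟩
  have hsm : s ≤ m := hsmin ⟨hm0, hB⟩
  have hrF' := lapAlpha_iterate_eq_zero_iff.1 hrF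
  have hsF' := lapBeta_iterate_eq_zero_iff.1 hsF
  have hmax : m = max r s := by
    refine le_antisymm (hmin ⟨lt_max_of_lt_left hr0, (lapBC_iterate_eq_zero_iff _ F).2
      ⟨lapAlpha_iterate_eq_zero_iff.2 fun β => ?_, lapBeta_iterate_eq_zero_iff.2 fun α => ?_⟩⟩)
      (max_le hrm hsm)
    · exact lap_iterate_eq_zero_of_le (le_max_left r s) (hrF' β)
    · exact lap_iterate_eq_zero_of_le (le_max_right r s) (hsF' α)
  obtain ⟨φ, hφC, hφ, hφre⟩ := exists_polyanalytic_rePart_eq hr0 (n := 2 * m) (by omega) hCp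
    (fun p => im_plus_eq_zero (hF _)) hrF'
  -- The coordinates are swapped so that β becomes the variable of polyharmonicity and α the
  -- parameter.
  obtain ⟨ψ, hψC, hψ, hψre⟩ := exists_polyanalytic_rePart_eq hs0 (n := 2 * m) (by omega)
    (f := fun p : ℂ × ℂ => minus (F (idem p.2 p.1)))
    (hCm.comp (contDiff_snd.prodMk contDiff_fst)) (fun p => im_minus_eq_zero (hF _)) hsF'
  let G : BC → BC := fun Z => idem (φ (minus Z) (plus Z)) (ψ (plus Z) (minus Z))
  have hG : ∀ α β, G (idem α β) = idem (φ β α) (ψ α β) := fun α β => by simp [G]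
  have hGp : ∀ β, (fun w => plus (G (idem w β))) = φ β := fun β => by
    ext w
    rw [hG, plus_idem]
  have hGm : ∀ α, (fun w => minus (G (idem α w))) = ψ α := fun α => by
    ext w
    rw [hG, minus_idem]
  refine ⟨r, s, hmax, ⟨⟨hr0, hrF⟩, hrmin⟩, ⟨⟨hs0, hsF⟩, hsmin⟩, φ, ψ, G, hφ, hψ, hG, ?_,
    ⟨?_, ⟨hm0, ?_⟩, ?_⟩, ?_⟩
  · intro Z
    have h1 := congrFun (hφre (minus Z)) (plus Z)
    have h2 := congrFun (hψre (plus Z)) (minus Z)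
    simp only [rePart, idem_plus_minus] at h1 h2
    rw [reHyp_eq]
    simp only [G, plus_idem, minus_idem]
    rw [h1, h2, idem_plus_minus]
  · rw [isCn_iff_idem]
    simp only [hG, plus_idem, minus_idem]
    exact ⟨hφC, hψC.comp (contDiff_snd.prodMk contDiff_fst)⟩
  · rw [lapBC_iterate_eq_zero_iff, lapAlpha_iterate_eq_zero_iff, lapBeta_iterate_eq_zero_iff]
    simp only [hGp, hGm]
    exact ⟨fun β => lap_iterate_polyanalytic hrm (hφ β),
      fun α => lap_iterate_polyanalytic hsm (hψ α)⟩
  -- A power of Δ_bc killing G also kills its hyperbolic real part F, so minimality of `m` passes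
  -- from F to G.
  · rintro k ⟨hk0, hk⟩
    refine hmin ⟨hk0, ?_⟩
    rw [lapBC_iterate_eq_zero_iff, lapAlpha_iterate_eq_zero_iff, lapBeta_iterate_eq_zero_iff]
      at hk ⊢
    simp only [hGp, hGm] at hk
    refine ⟨fun β => ?_, fun α => ?_⟩
    · rw [← hφre β, lap_iterate_rePart_polyanalytic k (hφ β), hk.1 β]
      ext z
      simp [rePart]
    · rw [← hψre α, lap_iterate_rePart_polyanalytic k (hψ α), hk.2 α]
      ext z
      simp [rePart]
  · rw [eq_zero_iff_forall_idem]
    intro α β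
    rw [dZstar_iterate_idem, hGp, hGm, dzbar_iterate_polyanalytic hrm (hφ β),
      dzbar_iterate_polyanalytic hsm (hψ α)]
    exact idem_zero
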